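/- Let $a\in\mathbb R$, $b>0$, $\rho>0$, $\ell>0$ and $\lambda,c,I,k\in\mathbb R$, and put $$\beta:=\Big(I-k-\frac ab\,\frac{\ell}{\rho}-\frac{\lambda c}{\rho}\Big)\frac{\rho+b}{\ell}+\frac ab .$$ For $\sigma>0$ consider the Ornstein–Uhlenbeck dynamics $dX_t=(a-bX_t)\,dt+\sigma\,dW_t$ on $\mathbb R$, and let $\psi_{\rho}=\psi_{\rho,\sigma}$ be the increasing fundamental solution of $$\tfrac12\sigma^2u''(x)+(a-bx)u'(x)-\rho u(x)=0,\qquad x\in\mathbb R,$$ that is, a strictly positive, strictly increasing $C^2$ solution. One such solution is $$\psi_{\rho,\sigma}(x)=e^{\frac{(bx-a)^2}{2\sigma^2 b}}\,D_{-\rho/b}\Big(-\frac{bx-a}{\sigma b}\sqrt{2b}\Big),\qquad D_\theta(y)=\frac{e^{-y^2/4}}{\Gamma(-\theta)}\int_0^\infty t^{-\theta-1}e^{-t^2/2-yt}\,dt\quad(\theta<0).$$ For every $\sigma>0$ the equation $$(x-\beta)\,\psi_{\rho,\sigma}'(x)-\psi_{\rho,\sigma}(x)=0$$ has exactly one root $x^*(\sigma)\in\mathbb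 R$ (the threshold for switching), and this root is the same for every strictly positive, strictly increasing $C^2$ solution of the differential equation. The mapping $\sigma\mapsto x^*(\sigma)$ is strictly increasing on $(0,\infty)$. -/

import Mathlib

namespace OUSwitching

/-- The parabolic cylinder function `D_θ(y)` of negative order `θ < 0`, through its integral
representation. -/
noncomputable def cylinderD (θ y : ℝ) : ℝ :=
  Real.exp (-(y ^ 2 / 4)) * (1 / Real.Gamma (-θ)) *
    ∫ t in Set.Ioi (0 : ℝ), t ^ (-θ - 1) * Real.exp (-(t ^ 2 / 2) - y * t)

/-- The generator `L u = (σ² / 2) u'' + (a - b x) u'` of the Ornstein–Uhlenbeck process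
`dX = (a - b X) dt + σ dW`. -/
noncomputable def generator (a b σ : ℝ) (u : ℝ → ℝ) (x : ℝ) : ℝ :=
  1 / 2 * σ ^ 2 * deriv (deriv u) x + (a - b * x) * deriv u x

/-- `u` is a strictly positive, strictly increasing `C²` solution of `L u - ρ u = 0` on `ℝ`. Such a
`u` is determined up to a positive multiplicative constant. -/
structure IsIncreasingFundamentalSolution (a b ρ σ : ℝ) (u : ℝ → ℝ) : Prop where
  contDiff : ContDiff ℝ 2 u
  ode : ∀ x, generator a b σ u x - ρ * u x = 0
  strictMono : StrictMono u
  pos : ∀ x, 0 < u x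

/-- The increasing fundamental solution in terms of the parabolic cylinder function. -/
noncomputable def psi (a b ρ σ x : ℝ) : ℝ :=
  Real.exp ((b * x - a) ^ 2 / (2 * σ ^ 2 * b)) *
    cylinderD (-(ρ / b)) (-((b * x - a) / (σ * b) * Real.sqrt (2 * b)))

/-- The constant `β = (I - k - (a/b)(ℓ/ρ) - λ c / ρ) (ρ + b) / ℓ + a / b`. -/
noncomputable def beta (a b ρ l lam c I k : ℝ) : ℝ :=
  (I - k - a / b * (l / ρ) - lam * c / ρ) * ((ρ + b) / l) + a / b

/-- The function `A(x) = (x - β) u'(x) - u(x)` whose root is the switching threshold. -/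
noncomputable def thresholdFun (β : ℝ) (u : ℝ → ℝ) (x : ℝ) : ℝ :=
  (x - β) * deriv u x - u x

end OUSwitching

open MeasureTheory Set Filter Topology

/-! With `p = ρ / b` and `κ = √(2b) / σ`, `psi` is a constant times `M_p (κ (x - a / b))`, where
`M_p` is `tiltedMoment p`. Here `M_p' = M_{p+1}`, and the differential equation becomes the
recurrence `M_{p+2} = z M_{p+1} + p M_p`. The threshold solves `(x - β) κ M_{p+1} / M_p = 1`. For
fixed `x` the factor `κ M_{p+1} / M_p` increases in `κ` (`strictMono_tiltedMoment_ratio`, from the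
correlation inequality `tiltedMoment_mul_lt`), so it decreases in `σ`. At the old root a larger `σ`
therefore makes the threshold function negative; that function increases to the right of `β`, so the
root moves right. A Wronskian argument shows that all increasing positive solutions share the root.
-/

namespace OUSwitching

/-! ### Moments of the tilted half-Gaussian weight. -/

/-- The integrand `t ^ (p - 1) exp (-t² / 2 + z t)` of the tilted half-Gaussian moment. -/
noncomputable def tiltedIntegrand (p z t : ℝ) : ℝ :=
  t ^ (p - 1) * Real.exp (-(t ^ 2 / 2) + z * t)

/-- The moment `∫₀^∞ t ^ (p - 1) exp (-t² / 2 + z t) dt` of the tilted half-Gaussian weight. -/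
noncomputable def tiltedMoment (p z : ℝ) : ℝ :=
  ∫ t in Ioi (0 : ℝ), tiltedIntegrand p z t

theorem tiltedIntegrand_pos (p z : ℝ) {t : ℝ} (ht : 0 < t) : 0 < tiltedIntegrand p z t := by
  unfold tiltedIntegrand
  positivity

theorem tiltedIntegrand_add_one (p z : ℝ) {t : ℝ} (ht : 0 < t) :
    tiltedIntegrand (p + 1) z t = t * tiltedIntegrand p z t := by
  unfold tiltedIntegrand
  rw [show p + 1 - 1 = (p - 1) + 1 by ring, Real.rpow_add_one ht.ne']
  ring

theorem measurable_tiltedIntegrand (p z : ℝ) : Measurable (tiltedIntegrand p z) := by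
  unfold tiltedIntegrand
  fun_prop

theorem integrableOn_tiltedIntegrand {p : ℝ} (hp : 0 < p) (z : ℝ) :
    IntegrableOn (tiltedIntegrand p z) (Ioi 0) := by
  -- The dominating function comes from `z t ≤ t² / 4 + z²`.
  have h := (integrableOn_rpow_mul_exp_neg_mul_sq (b := 1 / 4) (by norm_num)
    (s := p - 1) (by linarith)).mul_const (Real.exp (z ^ 2))
  refine Integrable.mono' h (measurable_tiltedIntegrand p z).aestronglyMeasurable ?_
  filter_upwards [ae_restrict_mem measurableSet_Ioi] with t ht
  rw [Real.norm_of_nonneg (tiltedIntegrand_pos p z ht).le, mul_assoc, ← Real.exp_add]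
  unfold tiltedIntegrand
  have ht' : (0 : ℝ) < t := ht
  refine mul_le_mul_of_nonneg_left (Real.exp_le_exp.2 ?_) (by positivity)
  nlinarith [sq_nonneg (t / 2 - z)]

/-- The exceptional point `c` accommodates the factor `(t - μ) ^ 2` in `tiltedMoment_mul_lt`. -/
theorem setIntegral_Ioi_pos {f : ℝ → ℝ} (hf : IntegrableOn f (Ioi 0)) (c : ℝ)
    (h0 : ∀ t, 0 < t → 0 ≤ f t) (hpos : ∀ t, 0 < t → t ≠ c → 0 < f t) :
    0 < ∫ t in Ioi (0 : ℝ), f t := by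
  rw [setIntegral_pos_iff_support_of_nonneg_ae _ hf]
  · have hsub : Ioi (max 0 c) ⊆ Function.support f ∩ Ioi 0 := fun t ht => by
      have ht' : max 0 c < t := ht
      have h1 := (le_max_left 0 c).trans_lt ht'
      exact ⟨(hpos t h1 ((le_max_right 0 c).trans_lt ht').ne').ne', h1⟩
    refine lt_of_lt_of_le ?_ (measure_mono hsub)
    simp
  · filter_upwards [ae_restrict_mem measurableSet_Ioi] with t ht using h0 t ht

theorem tiltedMoment_pos {p : ℝ} (hp : 0 < p) (z : ℝ) : 0 < tiltedMoment p z :=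
  setIntegral_Ioi_pos (integrableOn_tiltedIntegrand hp z) 0
    (fun _ ht => (tiltedIntegrand_pos p z ht).le) (fun _ ht _ => tiltedIntegrand_pos p z ht)

theorem hasDerivAt_tiltedMoment {p : ℝ} (hp : 0 < p) (z : ℝ) :
    HasDerivAt (tiltedMoment p) (tiltedMoment (p + 1) z) z := by
  refine (hasDerivAt_integral_of_dominated_loc_of_deriv_le (μ := volume.restrict (Ioi 0))
    (F := tiltedIntegrand p) (F' := tiltedIntegrand (p + 1))
    -- For `y` within `1` of `z` and `t > 0`, `y t ≤ (z + 1) t`.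
    (bound := tiltedIntegrand (p + 1) (z + 1)) (s := Metric.ball z 1)
    (Metric.ball_mem_nhds z one_pos)
    (Eventually.of_forall fun y => (measurable_tiltedIntegrand p y).aestronglyMeasurable)
    (integrableOn_tiltedIntegrand hp z)
    (measurable_tiltedIntegrand _ z).aestronglyMeasurable ?_
    (integrableOn_tiltedIntegrand (by linarith) _) ?_).2
  · filter_upwards [ae_restrict_mem measurableSet_Ioi] with t ht y hy
    have ht' : (0 : ℝ) < t := ht
    rw [Real.norm_of_nonneg (tiltedIntegrand_pos _ y ht').le]
    rw [Metric.mem_ball, Real.dist_eq] at hy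
    have := (abs_lt.1 hy).2
    unfold tiltedIntegrand
    gcongr
    linarith
  · filter_upwards [ae_restrict_mem measurableSet_Ioi] with t ht y _
    rw [tiltedIntegrand_add_one p y ht]
    have h : HasDerivAt (fun y : ℝ => -(t ^ 2 / 2) + y * t) t y := by
      simpa using ((hasDerivAt_id y).mul_const t).const_add (-(t ^ 2 / 2))
    refine (h.exp.const_mul (t ^ (p - 1))).congr_deriv ?_
    unfold tiltedIntegrand
    ring

/-- Integrate the derivative of `t ^ p exp (-t² / 2 + z t)` over `(0, ∞)`; both boundary terms
vanish, the one at `0` because `p > 0`. -/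
theorem tiltedMoment_add_two {p : ℝ} (hp : 0 < p) (z : ℝ) :
    tiltedMoment (p + 2) z = z * tiltedMoment (p + 1) z + p * tiltedMoment p z := by
  have i0 := (integrableOn_tiltedIntegrand hp z).const_mul p
  have i1 := (integrableOn_tiltedIntegrand (p := p + 1) (by linarith) z).const_mul z
  have i2 := integrableOn_tiltedIntegrand (p := p + 1 + 1) (by linarith) z
  have hd : ∀ t ∈ Ioi (0 : ℝ), HasDerivAt (tiltedIntegrand (p + 1) z)
      (p * tiltedIntegrand p z t + z * tiltedIntegrand (p + 1) z t
        - tiltedIntegrand (p + 1 + 1) z t) t := by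
    intro t ht
    have ht' : (0 : ℝ) < t := ht
    have h : HasDerivAt (fun t : ℝ => -(t ^ 2 / 2) + z * t) (-t + z) t := by
      refine (((hasDerivAt_pow 2 t).div_const 2).neg.add
        ((hasDerivAt_id t).const_mul z)).congr_deriv ?_
      simp
    have h2 := (Real.hasDerivAt_rpow_const (x := t) (p := p) (Or.inl ht'.ne')).mul h.exp
    rw [tiltedIntegrand_add_one (p + 1) z ht']
    unfold tiltedIntegrand
    simp only [add_sub_cancel_right]
    refine h2.congr_deriv ?_
    ring
  have hint := (i0.add i1).sub i2
  have hcont : ContinuousWithinAt (tiltedIntegrand (p + 1) z) (Ici 0) 0 := by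
    unfold tiltedIntegrand
    simp only [add_sub_cancel_right]
    have : ContinuousAt (fun t : ℝ => t ^ p) 0 := Real.continuousAt_rpow_const _ _ (Or.inr hp.le)
    exact (this.mul (by fun_prop)).continuousWithinAt
  have hlim := tendsto_zero_of_hasDerivAt_of_integrableOn_Ioi hd hint
    (integrableOn_tiltedIntegrand (by linarith) z)
  have key := integral_Ioi_of_hasDerivAt_of_tendsto hcont hd hint hlim
  have hz : tiltedIntegrand (p + 1) z 0 = 0 := by
    simp [tiltedIntegrand, Real.zero_rpow hp.ne']
  have e2 := integral_sub (i0.add i1) i2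
  have e1 := integral_add i0 i1
  simp only [Pi.add_apply] at e2
  rw [hz, e2, e1, integral_const_mul, integral_const_mul] at key
  rw [show p + 2 = p + 1 + 1 by ring]
  unfold tiltedMoment
  linarith

/-- Positive correlation of `t` and `t²` under the tilted weight. -/
theorem tiltedMoment_mul_lt {p : ℝ} (hp : 0 < p) (z : ℝ) :
    tiltedMoment (p + 1) z * tiltedMoment (p + 2) z <
      tiltedMoment p z * tiltedMoment (p + 3) z := by
  have M0 := tiltedMoment_pos hp z
  have M1 := tiltedMoment_pos (p := p + 1) (by linarith) z
  -- `μ` is the mean of `t` under the weight. Integrating `(t - μ) (t² - μ²) > 0` for `t ≠ μ` gives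
  -- the claim, since the `μ²` and `μ³` terms cancel.
  obtain ⟨μ, hμ⟩ : ∃ μ, μ = tiltedMoment (p + 1) z / tiltedMoment p z := ⟨_, rfl⟩
  have hμ0 : 0 < μ := hμ ▸ div_pos M1 M0
  have i0 := (integrableOn_tiltedIntegrand hp z).const_mul (μ ^ 3)
  have i1 := (integrableOn_tiltedIntegrand (p := p + 1) (by linarith) z).const_mul (μ ^ 2)
  have i2 := (integrableOn_tiltedIntegrand (p := p + 2) (by linarith) z).const_mul μ
  have i3 := integrableOn_tiltedIntegrand (p := p + 3) (by linarith) z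
  have hfact : ∀ t, 0 < t → tiltedIntegrand (p + 3) z t - μ * tiltedIntegrand (p + 2) z t
      - μ ^ 2 * tiltedIntegrand (p + 1) z t + μ ^ 3 * tiltedIntegrand p z t
      = (t - μ) ^ 2 * (t + μ) * tiltedIntegrand p z t := by
    intro t ht
    rw [show p + 3 = p + 1 + 1 + 1 by ring, show p + 2 = p + 1 + 1 by ring]
    simp only [tiltedIntegrand_add_one _ z ht]
    ring
  have key := setIntegral_Ioi_pos (((i3.sub i2).sub i1).add i0) μ
    (fun t ht => by
      have := tiltedIntegrand_pos p z ht
      refine le_of_le_of_eq ?_ (hfact t ht).symm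
      positivity)
    (fun t ht hne => by
      have := tiltedIntegrand_pos p z ht
      have := sub_ne_zero.2 hne
      refine lt_of_lt_of_eq ?_ (hfact t ht).symm
      positivity)
  rw [integral_add' ((i3.sub i2).sub i1) i0, integral_sub' (i3.sub i2) i1, integral_sub' i3 i2,
    integral_const_mul, integral_const_mul, integral_const_mul] at key
  change 0 < tiltedMoment (p + 3) z - μ * tiltedMoment (p + 2) z
      - μ ^ 2 * tiltedMoment (p + 1) z + μ ^ 3 * tiltedMoment p z at key
  have hM : tiltedMoment (p + 1) z = μ * tiltedMoment p z := by rw [hμ]; field_simp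
  rw [hM] at key ⊢
  nlinarith

theorem contDiff_tiltedMoment (n : ℕ) {p : ℝ} (hp : 0 < p) : ContDiff ℝ n (tiltedMoment p) := by
  have hd : ∀ {p : ℝ}, 0 < p → Differentiable ℝ (tiltedMoment p) := fun hp z =>
    (hasDerivAt_tiltedMoment hp z).differentiableAt
  induction n generalizing p with
  | zero => exact contDiff_zero.2 (hd hp).continuous
  | succ n ih =>
    rw [Nat.cast_succ, contDiff_succ_iff_deriv]
    refine ⟨hd hp, fun h => by simp at h, ?_⟩
    rw [funext fun z => (hasDerivAt_tiltedMoment hp z).deriv]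
    exact ih (by linarith)

/-- For fixed `w`, the function `κ M_{p+1}(κ w) / M_p(κ w)` is strictly increasing in `κ`. -/
theorem strictMono_tiltedMoment_ratio {p : ℝ} (hp : 0 < p) (w : ℝ) :
    StrictMono fun κ : ℝ => κ * tiltedMoment (p + 1) (κ * w) / tiltedMoment p (κ * w) := by
  have hp1 : 0 < p + 1 := by linarith
  refine strictMono_of_deriv_pos fun κ => ?_
  have hw : HasDerivAt (fun κ : ℝ => κ * w) w κ := by simpa using (hasDerivAt_id κ).mul_const w
  have M0 := tiltedMoment_pos hp (κ * w)
  have h0 := (hasDerivAt_tiltedMoment hp (κ * w)).comp κ hw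
  have h1 := (hasDerivAt_tiltedMoment hp1 (κ * w)).comp κ hw
  have h := ((hasDerivAt_id κ).mul h1).div h0 M0.ne'
  refine lt_of_lt_of_eq ?_ h.deriv.symm
  refine div_pos ?_ (by positivity)
  simp only [Function.comp, id, Pi.mul_apply]
  have r1 := tiltedMoment_add_two hp (κ * w)
  have r2 := tiltedMoment_add_two hp1 (κ * w)
  have hlt := tiltedMoment_mul_lt hp (κ * w)
  rw [show p + 1 + 2 = p + 3 by ring, show p + 1 + 1 = p + 2 by ring] at r2
  rw [show p + 1 + 1 = p + 2 by ring]
  -- The recurrence eliminates the explicit `κ * w`, whose sign is unknown, from the numerator of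
  -- the derivative.
  have e1 : tiltedMoment (p + 3) (κ * w) - (p + 1) * tiltedMoment (p + 1) (κ * w)
      = κ * w * tiltedMoment (p + 2) (κ * w) := by linarith
  have e2 : tiltedMoment (p + 2) (κ * w) - p * tiltedMoment p (κ * w)
      = κ * w * tiltedMoment (p + 1) (κ * w) := by linarith
  have : (1 * tiltedMoment (p + 1) (κ * w) + κ * (tiltedMoment (p + 2) (κ * w) * w))
        * tiltedMoment p (κ * w)
      - κ * tiltedMoment (p + 1) (κ * w) * (tiltedMoment (p + 1) (κ * w) * w)
      = tiltedMoment p (κ * w) * tiltedMoment (p + 3) (κ * w)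
        - tiltedMoment (p + 1) (κ * w) * tiltedMoment (p + 2) (κ * w) := by
    linear_combination -tiltedMoment p (κ * w) * e1 + tiltedMoment (p + 1) (κ * w) * e2
  rw [this]
  linarith

/-! ### The function `psi` in terms of moments. -/

/-- The rate `√(2b) / σ` in the normalized variable `z = √(2b) / σ * (x - a / b)`. -/
noncomputable def rate (b σ : ℝ) : ℝ := Real.sqrt (2 * b) / σ

/-- The Gaussian prefactor of `psi` cancels the factor `exp (-y² / 4)` in `cylinderD`. -/
theorem psi_eq {a b ρ σ : ℝ} (hb : 0 < b) (hσ : 0 < σ) (x : ℝ) :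
    psi a b ρ σ x =
      1 / Real.Gamma (ρ / b) * tiltedMoment (ρ / b) (rate b σ * (x - a / b)) := by
  have hs : Real.sqrt (2 * b) ^ 2 = 2 * b := Real.sq_sqrt (by positivity)
  have hz : (b * x - a) / (σ * b) * Real.sqrt (2 * b) = rate b σ * (x - a / b) := by
    unfold rate
    field_simp
  have hq : (rate b σ * (x - a / b)) ^ 2 / 4 = (b * x - a) ^ 2 / (2 * σ ^ 2 * b) := by
    rw [← hz, mul_pow, hs]
    field_simp
    ring
  unfold psi cylinderD tiltedMoment tiltedIntegrand
  rw [hz, neg_sq, hq, ← mul_assoc, ← mul_assoc, ← Real.exp_add, add_neg_cancel, Real.exp_zero,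
    one_mul, neg_neg]
  congr 1
  refine setIntegral_congr_fun measurableSet_Ioi fun t _ => ?_
  ring_nf

theorem rate_pos {b σ : ℝ} (hb : 0 < b) (hσ : 0 < σ) : 0 < rate b σ := by
  unfold rate
  positivity

theorem hasDerivAt_tiltedMoment_affine {p : ℝ} (hp : 0 < p) (C κ m x : ℝ) :
    HasDerivAt (fun x => C * tiltedMoment p (κ * (x - m)))
      (C * κ * tiltedMoment (p + 1) (κ * (x - m))) x := by
  have hw : HasDerivAt (fun x : ℝ => κ * (x - m)) κ x := by
    simpa using ((hasDerivAt_id x).sub_const m).const_mul κ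
  refine (((hasDerivAt_tiltedMoment hp (κ * (x - m))).comp x hw).const_mul C).congr_deriv ?_
  ring

section Psi

variable {a b ρ σ : ℝ}

theorem deriv_psi (hb : 0 < b) (hρ : 0 < ρ) (hσ : 0 < σ) :
    deriv (psi a b ρ σ) = fun x => 1 / Real.Gamma (ρ / b) * rate b σ *
      tiltedMoment (ρ / b + 1) (rate b σ * (x - a / b)) := by
  rw [funext (psi_eq hb hσ)]
  exact funext fun x => (hasDerivAt_tiltedMoment_affine (by positivity) _ _ _ x).deriv

theorem deriv_deriv_psi (hb : 0 < b) (hρ : 0 < ρ) (hσ : 0 < σ) :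
    deriv (deriv (psi a b ρ σ)) = fun x => 1 / Real.Gamma (ρ / b) * rate b σ * rate b σ *
      tiltedMoment (ρ / b + 1 + 1) (rate b σ * (x - a / b)) := by
  rw [deriv_psi hb hρ hσ]
  exact funext fun x => (hasDerivAt_tiltedMoment_affine (by positivity) _ _ _ x).deriv

theorem isIncreasingFundamentalSolution_psi (hb : 0 < b) (hρ : 0 < ρ) (hσ : 0 < σ) :
    IsIncreasingFundamentalSolution a b ρ σ (psi a b ρ σ) := by
  have hν : 0 < ρ / b := by positivity
  have hΓ := Real.Gamma_pos_of_pos hν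
  have hκ := rate_pos hb hσ
  refine ⟨?_, fun x => ?_, strictMono_of_deriv_pos fun x => ?_, fun x => ?_⟩
  · rw [funext (psi_eq hb hσ)]
    exact contDiff_const.mul ((contDiff_tiltedMoment 2 hν).comp (by fun_prop))
  · have hr := tiltedMoment_add_two hν (rate b σ * (x - a / b))
    have hκ2 : σ ^ 2 * rate b σ ^ 2 = 2 * b := by
      unfold rate
      rw [div_pow, Real.sq_sqrt (by positivity)]
      field_simp
    have hab : b * (a / b) = a := by field_simp
    have hbν : b * (ρ / b) = ρ := by field_simp
    simp only [generator]
    rw [deriv_deriv_psi hb hρ hσ, deriv_psi hb hρ hσ, psi_eq hb hσ]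
    simp only
    rw [show ρ / b + 1 + 1 = ρ / b + 2 by ring, hr]
    generalize tiltedMoment (ρ / b) _ = M0
    generalize tiltedMoment (ρ / b + 1) _ = M1
    generalize 1 / Real.Gamma (ρ / b) = C
    linear_combination (1 / 2 * C * (rate b σ * (x - a / b) * M1 + ρ / b * M0)) * hκ2
      - C * rate b σ * M1 * hab + C * M0 * hbν
  · rw [deriv_psi hb hρ hσ]
    have := tiltedMoment_pos (p := ρ / b + 1) (by positivity) (rate b σ * (x - a / b))
    positivity
  · rw [psi_eq hb hσ]
    have := tiltedMoment_pos hν (rate b σ * (x - a / b))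
    positivity

theorem deriv_deriv_psi_pos (hb : 0 < b) (hρ : 0 < ρ) (hσ : 0 < σ) (x : ℝ) :
    0 < deriv (deriv (psi a b ρ σ)) x := by
  rw [deriv_deriv_psi hb hρ hσ]
  have := tiltedMoment_pos (p := ρ / b + 1 + 1) (by positivity) (rate b σ * (x - a / b))
  have := Real.Gamma_pos_of_pos (show 0 < ρ / b by positivity)
  have := rate_pos hb hσ
  positivity

theorem monotone_deriv_deriv_psi (hb : 0 < b) (hρ : 0 < ρ) (hσ : 0 < σ) :
    Monotone (deriv (deriv (psi a b ρ σ))) := by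
  have hΓ := Real.Gamma_pos_of_pos (show 0 < ρ / b by positivity)
  have hκ := rate_pos hb hσ
  have hd := hasDerivAt_tiltedMoment_affine (p := ρ / b + 1 + 1) (by positivity)
    (1 / Real.Gamma (ρ / b) * rate b σ * rate b σ) (rate b σ) (a / b)
  rw [deriv_deriv_psi hb hρ hσ]
  refine monotone_of_deriv_nonneg (fun x => (hd x).differentiableAt) fun x => ?_
  rw [(hd x).deriv]
  have := tiltedMoment_pos (p := ρ / b + 1 + 1 + 1) (by positivity) (rate b σ * (x - a / b))
  positivity

end Psi

/-! ### Arbitrary increasing solutions and their Wronskian. -/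

namespace IsIncreasingFundamentalSolution

variable {a b ρ σ : ℝ} {u v : ℝ → ℝ}

theorem hasDerivAt (hu : IsIncreasingFundamentalSolution a b ρ σ u) (x : ℝ) :
    HasDerivAt u (deriv u x) x :=
  (hu.contDiff.differentiable (by norm_num) x).hasDerivAt

theorem hasDerivAt_deriv (hu : IsIncreasingFundamentalSolution a b ρ σ u) (x : ℝ) :
    HasDerivAt (deriv u) (deriv (deriv u) x) x := by
  have h : ContDiff ℝ 1 (deriv u) :=
    ((contDiff_succ_iff_deriv (n := 1)).1 (by simpa [one_add_one_eq_two] using hu.contDiff)).2.2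
  exact (h.differentiable (by norm_num) x).hasDerivAt

theorem deriv_nonneg (hu : IsIncreasingFundamentalSolution a b ρ σ u) (x : ℝ) : 0 ≤ deriv u x :=
  hu.strictMono.monotone.deriv_nonneg

/-- The Wronskian is a constant multiple of `exp ((b x - a)² / (b σ²))`. -/
theorem exists_wronskian_eq (hb : 0 < b) (hσ : 0 < σ)
    (hu : IsIncreasingFundamentalSolution a b ρ σ u)
    (hv : IsIncreasingFundamentalSolution a b ρ σ v) :
    ∃ C : ℝ, ∀ x, deriv u x * v x - u x * deriv v x =
      C * Real.exp ((b * x - a) ^ 2 / (b * σ ^ 2)) := by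
  -- Abel's identity: the Wronskian satisfies `W' = (2 (b x - a) / σ²) W`, so `F`, its product with
  -- the integrating factor, is constant.
  let F : ℝ → ℝ := fun x => (deriv u x * v x - u x * deriv v x) *
    Real.exp (-((b * x - a) ^ 2 / (b * σ ^ 2)))
  have hF : ∀ x, HasDerivAt F 0 x := by
    intro x
    have hW := ((hu.hasDerivAt_deriv x).mul (hv.hasDerivAt x)).sub
      ((hu.hasDerivAt x).mul (hv.hasDerivAt_deriv x))
    have hQ : HasDerivAt (fun x : ℝ => -((b * x - a) ^ 2 / (b * σ ^ 2)))
        (-(2 * (b * x - a) / σ ^ 2)) x := by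
      have h1 : HasDerivAt (fun x : ℝ => b * x - a) b x := by
        simpa using ((hasDerivAt_id x).const_mul b).sub_const a
      refine ((h1.pow 2).div_const (b * σ ^ 2)).neg.congr_deriv ?_
      field_simp
      norm_num [mul_comm]
    have ou := hu.ode x
    have ov := hv.ode x
    unfold generator at ou ov
    have hu2 : deriv (deriv u) x = 2 * (ρ * u x - (a - b * x) * deriv u x) / σ ^ 2 := by
      field_simp
      linarith
    have hv2 : deriv (deriv v) x = 2 * (ρ * v x - (a - b * x) * deriv v x) / σ ^ 2 := by
      field_simp
      linarith
    refine (hW.mul hQ.exp).congr_deriv ?_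
    simp only [Pi.sub_apply, Pi.mul_apply]
    rw [hu2, hv2]
    field_simp
    ring
  refine ⟨F 0, fun x => ?_⟩
  rw [is_const_of_deriv_eq_zero (fun x => (hF x).differentiableAt) (fun x => (hF x).deriv) 0 x]
  simp only [F]
  rw [mul_assoc, ← Real.exp_add, neg_add_cancel, Real.exp_zero, mul_one]

/-- A positive function cannot have derivative bounded below by a positive constant near `-∞`. -/
theorem not_forall_le_deriv (hu : IsIncreasingFundamentalSolution a b ρ σ u) {ε : ℝ} (hε : 0 < ε) :
    ¬ ∀ x ≤ 0, ε ≤ deriv u x := by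
  intro h
  -- With slope at least `ε`, `u` would have dropped to `0` or below at this point.
  have hx : -(u 0 / ε) < 0 := neg_lt_zero.2 (div_pos (hu.pos 0) hε)
  obtain ⟨y, hy, hy'⟩ := exists_deriv_eq_slope u hx
    (hu.contDiff.continuous.continuousOn)
    (fun x _ => (hu.hasDerivAt x).differentiableAt.differentiableWithinAt)
  have h1 := h y hy.2.le
  rw [hy', le_div_iff₀ (by linarith)] at h1
  have h2 : ε * (0 - -(u 0 / ε)) = u 0 := by field_simp; ring
  have := hu.pos (-(u 0 / ε))
  linarith

/-- If `C > 0`, then `u' v ≥ C` everywhere, and `v ≤ v 0` on `(-∞, 0]` keeps `u'` above `C / v 0`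
there, contradicting `u > 0`. Exchanging `u` and `v` then makes the Wronskian vanish. -/
theorem wronskian_nonpos (hb : 0 < b) (hσ : 0 < σ)
    (hu : IsIncreasingFundamentalSolution a b ρ σ u)
    (hv : IsIncreasingFundamentalSolution a b ρ σ v) (x : ℝ) :
    deriv u x * v x - u x * deriv v x ≤ 0 := by
  obtain ⟨C, hC⟩ := exists_wronskian_eq hb hσ hu hv
  rw [hC]
  refine mul_nonpos_of_nonpos_of_nonneg (not_lt.1 fun hpos => ?_) (Real.exp_pos _).le
  refine hu.not_forall_le_deriv (div_pos hpos (hv.pos 0)) fun y hy => ?_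
  have h1 : C ≤ C * Real.exp ((b * y - a) ^ 2 / (b * σ ^ 2)) :=
    le_mul_of_one_le_right hpos.le (Real.one_le_exp (by positivity))
  have h2 := mul_nonneg (hu.pos y).le (hv.deriv_nonneg y)
  have h3 := mul_le_mul_of_nonneg_left (hv.strictMono.monotone hy) (hu.deriv_nonneg y)
  rw [div_le_iff₀ (hv.pos 0)]
  linarith [hC y]

theorem wronskian_eq_zero (hb : 0 < b) (hσ : 0 < σ)
    (hu : IsIncreasingFundamentalSolution a b ρ σ u)
    (hv : IsIncreasingFundamentalSolution a b ρ σ v) (x : ℝ) :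
    deriv u x * v x = u x * deriv v x := by
  have h1 := wronskian_nonpos hb hσ hu hv x
  have h2 := wronskian_nonpos hb hσ hv hu x
  linarith

theorem thresholdFun_eq_zero_iff (hb : 0 < b) (hσ : 0 < σ)
    (hu : IsIncreasingFundamentalSolution a b ρ σ u)
    (hv : IsIncreasingFundamentalSolution a b ρ σ v) (β x : ℝ) :
    thresholdFun β u x = 0 ↔ thresholdFun β v x = 0 := by
  have h : thresholdFun β u x * v x = thresholdFun β v x * u x := by
    unfold thresholdFun
    linear_combination (x - β) * wronskian_eq_zero hb hσ hu hv x
  constructor <;> intro h0 <;> rw [h0, zero_mul] at h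
  · exact (mul_eq_zero.1 h.symm).resolve_right (hu.pos x).ne'
  · exact (mul_eq_zero.1 h).resolve_right (hv.pos x).ne'

theorem hasDerivAt_thresholdFun (hu : IsIncreasingFundamentalSolution a b ρ σ u) (β x : ℝ) :
    HasDerivAt (thresholdFun β u) ((x - β) * deriv (deriv u) x) x := by
  refine ((((hasDerivAt_id x).sub_const β).mul (hu.hasDerivAt_deriv x)).sub
    (hu.hasDerivAt x)).congr_deriv ?_
  simp

theorem lt_of_thresholdFun_nonneg (hu : IsIncreasingFundamentalSolution a b ρ σ u) {β x : ℝ}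
    (h : 0 ≤ thresholdFun β u x) : β < x := by
  by_contra! hx
  unfold thresholdFun at h
  have := mul_nonpos_of_nonpos_of_nonneg (sub_nonpos.2 hx) (hu.deriv_nonneg x)
  linarith [hu.pos x]

end IsIncreasingFundamentalSolution

/-! ### Existence, uniqueness and monotonicity of the threshold. -/

section Threshold

variable {a b ρ σ : ℝ}

theorem strictMonoOn_thresholdFun_psi (hb : 0 < b) (hρ : 0 < ρ) (hσ : 0 < σ) (β : ℝ) :
    StrictMonoOn (thresholdFun β (psi a b ρ σ)) (Ici β) := by
  have hd := (isIncreasingFundamentalSolution_psi (a := a) hb hρ hσ).hasDerivAt_thresholdFun β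
  refine strictMonoOn_of_deriv_pos (convex_Ici β)
    (fun x _ => (hd x).continuousAt.continuousWithinAt) fun x hx => ?_
  rw [interior_Ici] at hx
  rw [(hd x).deriv]
  exact mul_pos (sub_pos.2 hx) (deriv_deriv_psi_pos hb hρ hσ x)

theorem exists_thresholdFun_psi_pos (hb : 0 < b) (hρ : 0 < ρ) (hσ : 0 < σ) (β : ℝ) :
    ∃ y, β < y ∧ 0 < thresholdFun β (psi a b ρ σ) y := by
  have hd := (isIncreasingFundamentalSolution_psi (a := a) hb hρ hσ).hasDerivAt_thresholdFun β
  set A := thresholdFun β (psi a b ρ σ) with hA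
  have hmono := strictMonoOn_thresholdFun_psi (a := a) hb hρ hσ β
  have hk := deriv_deriv_psi_pos (a := a) hb hρ hσ (β + 1)
  set k := deriv (deriv (psi a b ρ σ)) (β + 1) with hkdef
  -- Beyond `β + 1` the slope `(x - β) ψ''` of `A` is at least `k`, since `ψ''` is monotone; over
  -- this length `A` gains at least `|A (β + 1)| + 1`.
  obtain ⟨y, hy⟩ : ∃ y, y = β + 1 + (|A (β + 1)| + 1) / k := ⟨_, rfl⟩
  have hlt : β + 1 < y := by
    rw [hy]
    exact lt_add_of_pos_right _ (by positivity)
  refine ⟨y, by linarith, ?_⟩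
  obtain ⟨c, hc, hc'⟩ := exists_hasDerivAt_eq_slope A _ hlt
    (fun x _ => (hd x).continuousAt.continuousWithinAt) (fun x _ => hd x)
  have h1 : k ≤ (c - β) * deriv (deriv (psi a b ρ σ)) c := by
    have h2 := monotone_deriv_deriv_psi (a := a) hb hρ hσ hc.1.le
    have h3 := hc.1
    nlinarith
  rw [hc', le_div_iff₀ (by linarith)] at h1
  have h2 : k * (y - (β + 1)) = |A (β + 1)| + 1 := by
    rw [hy]
    field_simp
    ring
  have := neg_abs_le (A (β + 1))
  linarith

theorem exists_thresholdFun_psi_eq_zero (hb : 0 < b) (hρ : 0 < ρ) (hσ : 0 < σ) (β : ℝ) :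
    ∃ x, thresholdFun β (psi a b ρ σ) x = 0 := by
  have hψ := isIncreasingFundamentalSolution_psi (a := a) hb hρ hσ
  obtain ⟨y, hy, hpos⟩ := exists_thresholdFun_psi_pos (a := a) hb hρ hσ β
  obtain ⟨x, -, hx⟩ := intermediate_value_Icc hy.le
    (fun x _ => (hψ.hasDerivAt_thresholdFun β x).continuousAt.continuousWithinAt)
    ⟨not_lt.1 fun h => (hψ.lt_of_thresholdFun_nonneg h.le).false, hpos.le⟩
  exact ⟨x, hx⟩

/-- Increasing the volatility makes the threshold function negative at the old threshold. -/
theorem thresholdFun_psi_neg_of_lt (hb : 0 < b) (hρ : 0 < ρ) {τ : ℝ} (hσ : 0 < σ) (hστ : σ < τ)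
    {β x : ℝ} (hx : thresholdFun β (psi a b ρ σ) x = 0) :
    thresholdFun β (psi a b ρ τ) x < 0 := by
  have hτ := hσ.trans hστ
  have hν : 0 < ρ / b := by positivity
  have hβ := (isIncreasingFundamentalSolution_psi hb hρ hσ).lt_of_thresholdFun_nonneg hx.ge
  have hΓ := Real.Gamma_pos_of_pos hν
  have hrate : rate b τ < rate b σ := by
    unfold rate
    gcongr
  have hr := strictMono_tiltedMoment_ratio hν (x - a / b) hrate
  -- Factoring out `psi > 0` leaves a bracket that depends on the volatility only through the
  -- monotone ratio.
  have form : ∀ {s : ℝ}, 0 < s → thresholdFun β (psi a b ρ s) x =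
      1 / Real.Gamma (ρ / b) * tiltedMoment (ρ / b) (rate b s * (x - a / b)) *
        ((x - β) * (rate b s * tiltedMoment (ρ / b + 1) (rate b s * (x - a / b)) /
          tiltedMoment (ρ / b) (rate b s * (x - a / b))) - 1) := by
    intro s hs
    have := (tiltedMoment_pos hν (rate b s * (x - a / b))).ne'
    unfold thresholdFun
    rw [deriv_psi hb hρ hs, psi_eq hb hs]
    beta_reduce
    generalize tiltedMoment (ρ / b) _ = M at *
    generalize tiltedMoment (ρ / b + 1) _ = N
    field_simp
  rw [form hτ]
  have Mσ := tiltedMoment_pos hν (rate b σ * (x - a / b))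
  have Mτ := tiltedMoment_pos hν (rate b τ * (x - a / b))
  have h0 := (mul_eq_zero.1 ((form hσ).symm.trans hx)).resolve_left (by positivity)
  refine mul_neg_of_pos_of_neg (by positivity) ?_
  have := mul_lt_mul_of_pos_left hr (sub_pos.2 hβ)
  simp only at this
  linarith

end Threshold

end OUSwitching

open OUSwitching in
theorem proposition1 (a b ρ l lam c I k : ℝ) (hb : 0 < b) (hρ : 0 < ρ) (hl : 0 < l) :
    (∀ σ : ℝ, 0 < σ →
      OUSwitching.IsIncreasingFundamentalSolution a b ρ σ (OUSwitching.psi a b ρ σ)) ∧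
    ∃ xstar : ℝ → ℝ,
      (∀ σ : ℝ, 0 < σ → ∀ u : ℝ → ℝ,
        OUSwitching.IsIncreasingFundamentalSolution a b ρ σ u →
          ∀ x : ℝ, OUSwitching.thresholdFun (OUSwitching.beta a b ρ l lam c I k) u x = 0 ↔
            x = xstar σ) ∧
      StrictMonoOn xstar (Set.Ioi 0) := by
  have hψ : ∀ σ : ℝ, 0 < σ → IsIncreasingFundamentalSolution a b ρ σ (psi a b ρ σ) :=
    fun σ hσ => isIncreasingFundamentalSolution_psi hb hρ hσ
  refine ⟨hψ, ?_⟩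
  generalize beta a b ρ l lam c I k = β
  have hroot : ∀ σ : ℝ, ∃ x, 0 < σ → thresholdFun β (psi a b ρ σ) x = 0 := fun σ => by
    by_cases hσ : 0 < σ
    · obtain ⟨x, hx⟩ := exists_thresholdFun_psi_eq_zero (a := a) hb hρ hσ β
      exact ⟨x, fun _ => hx⟩
    -- An arbitrary value off the domain `σ > 0`.
    · exact ⟨0, fun h => absurd h hσ⟩
  choose xstar hxstar using hroot
  refine ⟨xstar, fun σ hσ u hu x => ?_, fun σ hσ τ hτ hστ => ?_⟩
  · rw [hu.thresholdFun_eq_zero_iff hb hσ (hψ σ hσ)]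
    refine ⟨fun hx => ?_, fun hx => hx ▸ hxstar σ hσ⟩
    have hx' := hxstar σ hσ
    exact (strictMonoOn_thresholdFun_psi hb hρ hσ β).injOn
      ((hψ σ hσ).lt_of_thresholdFun_nonneg hx.ge).le
      ((hψ σ hσ).lt_of_thresholdFun_nonneg hx'.ge).le (hx.trans hx'.symm)
  · have hneg := thresholdFun_psi_neg_of_lt hb hρ hσ hστ (hxstar σ hσ)
    have hβ := (hψ σ hσ).lt_of_thresholdFun_nonneg (hxstar σ hσ).ge
    have hβ' := (hψ τ hτ).lt_of_thresholdFun_nonneg (hxstar τ hτ).ge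
    -- Both roots lie to the right of `β`, where the function for `τ` is increasing, so comparing
    -- its values orders them.
    refine ((strictMonoOn_thresholdFun_psi (a := a) hb hρ hτ β).lt_iff_lt hβ.le hβ'.le).1 ?_
    rw [hxstar τ hτ]
    exact hneg
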